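/- Let $G=(V,E)$ be a finite simple graph. The cycle matroid $M(G)$ is the matroid on the ground set $E$ whose bases are the maximal sets of edges containing no cycle of $G$, and $\operatorname{rank}(A)$ denotes the rank of $A\subseteq E$ in $M(G)$, that is, the largest size of a cycle-free subset of $A$. The graph $G$ is called uniformly dense if $\frac{|A|}{\operatorname{rank}(A)}\le\frac{|E|}{\operatorname{rank}(E)}$ for every nonempty $A\subseteq E$. A perfect matching of a graph is a set of edges that covers every vertex exactly once, and $G\setminus v$ is the graph obtained from $G$ by removing the vertex $v$ and all edges containing it. Corollary. Let $G$ be a connected, regular, uniformly dense finite simple graph. Then either $G$ has a perfect matching, or $G\setminus v$ has a perfect matching for every vertex $v\in V$, and these two alternatives exclude each other. -/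

import Mathlib

namespace SimpleGraph

variable {V : Type*}

/-- A set `A` of edges of `G` is a forest of `G` if the graph `(V, A)` contains no cycle. -/
def IsForestSet (G : SimpleGraph V) (A : Set (Sym2 V)) : Prop :=
  A ⊆ G.edgeSet ∧ (fromEdgeSet A).IsAcyclic

theorem maximal_isForestSet_iff (G : SimpleGraph V) {A : Set (Sym2 V)} (hA : G.IsForestSet A) :
    Maximal G.IsForestSet A ↔ (fromEdgeSet A).Reachable = G.Reachable := by
  have hle : fromEdgeSet A ≤ G := G.fromEdgeSet_le.mpr (by grind [IsForestSet])
  rw [← maximal_isAcyclic_iff_reachable_eq hle hA.2]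
  constructor
  · intro h
    refine ⟨⟨hle, hA.2⟩, fun H hH hAH => ?_⟩
    have h1 : G.IsForestSet H.edgeSet := ⟨edgeSet_mono hH.1, by simpa using hH.2⟩
    have h2 : A ⊆ H.edgeSet := fun e he =>
      edgeSet_mono hAH (by simpa using ⟨he, G.not_isDiag_of_mem_edgeSet (hA.1 he)⟩)
    have h3 : H.edgeSet ⊆ A := h.2 h1 h2
    simpa using fromEdgeSet_mono h3
  · intro h
    refine ⟨hA, fun B hB hAB => ?_⟩
    have hBle : fromEdgeSet B ≤ G := G.fromEdgeSet_le.mpr (by grind [IsForestSet])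
    have h1 : fromEdgeSet B ≤ fromEdgeSet A := h.2 ⟨hBle, hB.2⟩ (fromEdgeSet_mono hAB)
    intro e he
    have h2 := edgeSet_mono h1
      (show e ∈ (fromEdgeSet B).edgeSet by
        simpa using ⟨he, G.not_isDiag_of_mem_edgeSet (hB.1 he)⟩)
    simp at h2
    exact h2.1

/-- The cycle matroid of `G`: its ground set is the edge set of `G`, its independent sets are the
sets of edges that contain no cycle, and so its bases are the maximal such sets. -/
def cycleMatroid (G : SimpleGraph V) : Matroid (Sym2 V) :=
  (IndepMatroid.ofFinitary G.edgeSet G.IsForestSet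
    (by simp [IsForestSet])
    (fun I J hJ hIJ => ⟨hIJ.trans hJ.1, hJ.2.anti (fromEdgeSet_mono hIJ)⟩)
    (by
      intro I B hI hImax hB
      by_contra! hcon
      refine hImax ((maximal_isForestSet_iff G hI).2 ?_)
      have hBr := (maximal_isForestSet_iff G hB.1).1 hB
      have hle : fromEdgeSet I ≤ G := G.fromEdgeSet_le.mpr (by grind [IsForestSet])
      have key : ∀ u v, (fromEdgeSet B).Adj u v → (fromEdgeSet I).Reachable u v := by
        intro u v huv
        by_contra hn
        rw [fromEdgeSet_adj] at huv
        by_cases hm : s(u, v) ∈ I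
        · exact hn (Adj.reachable ((fromEdgeSet_adj I).2 ⟨hm, huv.2⟩))
        · refine hcon s(u, v) ⟨huv.1, hm⟩ ⟨Set.insert_subset (hB.1.1 huv.1) hI.1, ?_⟩
          have := IsAcyclic.sup_edge_of_not_reachable hn hI.2
          rwa [edge, ← fromEdgeSet_union, Set.union_singleton] at this
      ext u v
      refine ⟨fun h => h.mono hle, fun h => ?_⟩
      rw [← hBr] at h
      obtain ⟨p⟩ := h
      induction p with
      | nil => exact Reachable.refl _
      | cons h p ih => exact (key _ _ h).trans ih)
    (by
      intro I hI
      refine ⟨fun e he => (hI {e} (by simpa using he) (Set.finite_singleton e)).1 rfl, ?_⟩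
      intro v p hp
      have hmem : ∀ e ∈ p.edges, e ∈ I := fun e he => by
        have := p.edges_subset_edgeSet he
        simp at this
        exact this.1
      have hJ := hI {e | e ∈ p.edges} hmem p.edges.finite_toSet
      have hsub : ∀ e ∈ p.edges, e ∈ (fromEdgeSet {e | e ∈ p.edges}).edgeSet := fun e he => by
        simpa using ⟨he, (fromEdgeSet I).not_isDiag_of_mem_edgeSet (p.edges_subset_edgeSet he)⟩
      exact hJ.2 _ (hp.transfer hsub))
    (fun _ hI => hI.1)).matroid

@[simp] theorem cycleMatroid_ground (G : SimpleGraph V) : G.cycleMatroid.E = G.edgeSet := rfl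

@[simp] theorem cycleMatroid_indep_iff (G : SimpleGraph V) {A : Set (Sym2 V)} :
    G.cycleMatroid.Indep A ↔ A ⊆ G.edgeSet ∧ (fromEdgeSet A).IsAcyclic := Iff.rfl

end SimpleGraph

namespace Matroid

variable {α : Type*}

/-- The density `|A| / rank(A)` of a set `A` of elements of a finite matroid. In a loopless matroid
(such as the cycle matroid of a simple graph) the rank of a nonempty `A` is positive. -/
noncomputable def density (M : Matroid α) (A : Set α) : ℚ :=
  (A.ncard : ℚ) / ((M.eRk A).toNat : ℚ)

/-- A finite loopless matroid is uniformly dense if no nonempty set of its elements is denser than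
the whole ground set. -/
def UniformlyDense (M : Matroid α) : Prop :=
  ∀ A : Set α, A ⊆ M.E → A.Nonempty → M.density A ≤ M.density M.E

end Matroid

namespace SimpleGraph

variable {V : Type*}

/-- A graph is uniformly dense if its cycle matroid is. -/
def UniformlyDense (G : SimpleGraph V) : Prop :=
  G.cycleMatroid.UniformlyDense

/-- `G` has a perfect matching: a set of edges covering every vertex exactly once. -/
def HasPerfectMatching (G : SimpleGraph V) : Prop :=
  ∃ M : G.Subgraph, M.IsPerfectMatching

end SimpleGraph

namespace SimpleGraph

variable {V W : Type*}

/-! The core is 1-toughness: deleting `s > 0` of the `n` vertices leaves at most `s` components. If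
`q` remain, the surviving edges `A` have rank at most `n - s - q`, while `|A| ≥ |E| - s d` and `|E|
= n d / 2` by regularity. Uniform density against rank `n - 1` of `E` then rules out `q ≥ s + 1`.
Tutte's theorem finishes: removing `u`, after at most one vertex of `G`, leaves at most `|u| + 1`
components, and for even order parity forbids exactly `|u| + 1` odd ones. -/

theorem IsAcyclic.ncard_edgeSet_add_card_connectedComponent_le [Finite V] {G : SimpleGraph V}
    (hG : G.IsAcyclic) : G.edgeSet.ncard + Nat.card G.ConnectedComponent ≤ Nat.card V := by
  induction hn : G.edgeSet.ncard generalizing G with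
  | zero =>
    simpa using Nat.card_le_card_of_surjective G.connectedComponentMk Quot.mk_surjective
  | succ n ih =>
    obtain ⟨e, he⟩ : G.edgeSet.Nonempty := by
      rw [← Set.ncard_pos]; omega
    induction e with | h u v =>
    have hle : G.deleteEdges {s(u, v)} ≤ G := deleteEdges_le _
    have hcard : (G.deleteEdges {s(u, v)}).edgeSet.ncard = n := by
      rw [edgeSet_deleteEdges, Set.ncard_sdiff_singleton_of_mem he, hn]; rfl
    have h1 := ih (hG.anti hle) hcard
    have h2 : Nat.card G.ConnectedComponent
        < Nat.card (G.deleteEdges {s(u, v)}).ConnectedComponent := by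
      classical
      have := Fintype.ofFinite (G.deleteEdges {s(u, v)}).ConnectedComponent
      have := Fintype.ofFinite G.ConnectedComponent
      rw [Nat.card_eq_fintype_card, Nat.card_eq_fintype_card]
      refine Fintype.card_lt_of_surjective_not_injective _
        (ConnectedComponent.surjective_map_ofLE hle) fun hinj => ?_
      -- In a forest every edge is a bridge, so deleting one separates its ends.
      have hb := isAcyclic_iff_forall_adj_isBridge.1 hG he
      rw [isBridge_iff] at hb
      refine hb (ConnectedComponent.exact (hinj ?_))
      exact ConnectedComponent.sound (Adj.reachable he)
    omega

theorem Connected.card_le_toNat_eRk_ground_add_one [Finite V] {G : SimpleGraph V}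
    (hG : G.Connected) :
    Nat.card V ≤ (G.cycleMatroid.eRk G.cycleMatroid.E).toNat + 1 := by
  classical
  obtain ⟨T, hTG, hT⟩ := hG.exists_isTree_le
  have hind : G.cycleMatroid.Indep T.edgeSet :=
    ⟨edgeSet_mono hTG, by simpa using hT.isAcyclic⟩
  have h := hind.encard_le_eRk_of_subset (X := G.cycleMatroid.E) (edgeSet_mono hTG)
  have hfin : G.cycleMatroid.eRk G.cycleMatroid.E ≠ ⊤ :=
    ne_top_of_le_ne_top (Set.encard_ne_top_iff.2 (Set.toFinite G.edgeSet))
      (Matroid.eRk_le_encard _ _)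
  have h' := ENat.toNat_le_toNat h hfin
  have h3 := hT.connected.card_vert_le_card_edgeSet_add_one
  rw [Nat.card_coe_set_eq] at h3
  exact h3.trans (Nat.add_le_add_right h' 1)

/-- A basis of the image pulls back to a forest of `H`, which has at least as many components as
`H`. -/
theorem toNat_eRk_cycleMatroid_add_card_connectedComponent_le [Finite W]
    {H : SimpleGraph W} {G : SimpleGraph V} (φ : H ↪g G) :
    (G.cycleMatroid.eRk (Sym2.map φ '' H.edgeSet)).toNat + Nat.card H.ConnectedComponent
      ≤ Nat.card W := by
  obtain ⟨F, hF⟩ := G.cycleMatroid.exists_isBasis' (Sym2.map φ '' H.edgeSet)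
  have hac : (fromEdgeSet F).IsAcyclic := hF.indep.2
  have hac' : ((fromEdgeSet F).comap φ).IsAcyclic := hac.of_comap φ.toEmbedding
  have hle : (fromEdgeSet F).comap φ ≤ H := by
    intro a b hab
    have := (G.fromEdgeSet_le.2 (fun e he => hF.indep.1 he.1)) hab
    exact φ.map_adj_iff.1 this
  have hFim : F ⊆ Sym2.map φ '' ((fromEdgeSet F).comap φ).edgeSet := by
    intro e he
    obtain ⟨e', he', rfl⟩ := hF.subset he
    refine ⟨e', ?_, rfl⟩
    induction e' with | h a b =>
    exact ⟨he, fun h => H.ne_of_adj he' (φ.injective h)⟩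
  have hcard : F.ncard ≤ ((fromEdgeSet F).comap φ).edgeSet.ncard :=
    (Set.ncard_le_ncard hFim (Set.toFinite _)).trans (Set.ncard_image_le (Set.toFinite _))
  have h1 := hac'.ncard_edgeSet_add_card_connectedComponent_le
  have h2 := ConnectedComponent.card_le_card_of_le hle
  rw [hF.eRk_eq_encard]
  change F.ncard + _ ≤ _
  omega

/-- An edge not coming from `H` meets a vertex outside the range, and each such vertex carries `d`
edges. -/
theorem IsRegularOfDegree.ncard_edgeSet_le [Finite V] {H : SimpleGraph W} {G : SimpleGraph V}
    [G.LocallyFinite] {d : ℕ} (hreg : G.IsRegularOfDegree d) (φ : H ↪g G) :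
    G.edgeSet.ncard ≤ (Sym2.map φ '' H.edgeSet).ncard + (Set.range φ)ᶜ.ncard * d := by
  classical
  have := Fintype.ofFinite V
  have hsub : G.edgeSet ⊆ Sym2.map φ '' H.edgeSet ∪
      ⋃ v ∈ (Set.range φ)ᶜ.toFinset, G.incidenceSet v := by
    intro e he
    induction e with | h u v =>
    by_cases hu : u ∈ Set.range φ
    · by_cases hv : v ∈ Set.range φ
      · obtain ⟨a, rfl⟩ := hu
        obtain ⟨b, rfl⟩ := hv
        exact Or.inl ⟨s(a, b), φ.map_adj_iff.1 he, rfl⟩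
      · refine Or.inr (Set.mem_biUnion (x := v) (by simpa using hv) ⟨he, by simp⟩)
    · refine Or.inr (Set.mem_biUnion (x := u) (by simpa using hu) ⟨he, by simp⟩)
  refine (Set.ncard_le_ncard hsub (Set.toFinite _)).trans ((Set.ncard_union_le _ _).trans ?_)
  gcongr
  refine (Finset.set_ncard_biUnion_le _ _).trans ?_
  rw [Set.ncard_eq_toFinset_card' (Set.range φ)ᶜ, ← smul_eq_mul]
  refine Finset.sum_le_card_nsmul _ _ _ fun v _ => ?_
  rw [Set.ncard_eq_toFinset_card', Set.toFinset_card, card_incidenceSet_eq_degree, hreg v]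

theorem UniformlyDense.ncard_mul_le [Finite V] {G : SimpleGraph V} (hG : G.UniformlyDense)
    {A : Set (Sym2 V)} (hA : A ⊆ G.edgeSet) :
    A.ncard * (G.cycleMatroid.eRk G.cycleMatroid.E).toNat
      ≤ G.edgeSet.ncard * (G.cycleMatroid.eRk A).toNat := by
  rcases A.eq_empty_or_nonempty with rfl | hne
  · simp
  have hfin : ∀ B, G.cycleMatroid.eRk B ≠ ⊤ := fun B =>
    ne_top_of_le_ne_top (Set.encard_ne_top_iff.2 (Set.toFinite B))
      (Matroid.eRk_le_encard _ _)
  have hpos : 0 < (G.cycleMatroid.eRk A).toNat := by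
    obtain ⟨e, he⟩ := hne
    have hind : G.cycleMatroid.Indep {e} := by
      refine ⟨by simpa using hA he, ?_⟩
      induction e with | h u v =>
      simpa [edge] using (isAcyclic_bot (V := V)).sup_edge_of_not_reachable (u := u) (v := v)
        (by simpa using (G.ne_of_adj (hA he)))
    have := ENat.toNat_le_toNat (hind.encard_le_eRk_of_subset (by simpa using he)) (hfin A)
    rwa [Set.encard_singleton] at this
  have hle : (G.cycleMatroid.eRk A).toNat ≤ (G.cycleMatroid.eRk G.cycleMatroid.E).toNat :=
    ENat.toNat_le_toNat (Matroid.eRk_mono _ hA) (hfin _)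
  have h := hG A hA hne
  rw [Matroid.density, Matroid.density, div_le_div_iff₀ (by exact_mod_cast hpos)
    (by exact_mod_cast hpos.trans_le hle)] at h
  exact_mod_cast h

/-- A connected regular uniformly dense graph is `1`-tough. -/
theorem UniformlyDense.card_connectedComponent_le [Finite V] {H : SimpleGraph W}
    {G : SimpleGraph V} [G.LocallyFinite] (hG : G.UniformlyDense) (hconn : G.Connected) {d : ℕ}
    (hreg : G.IsRegularOfDegree d) (φ : H ↪g G) (hne : (Set.range φ)ᶜ.Nonempty) :
    Nat.card H.ConnectedComponent ≤ (Set.range φ)ᶜ.ncard := by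
  classical
  have := Fintype.ofFinite V
  have : Finite W := Finite.of_injective φ φ.injective
  have hW : Nat.card W + (Set.range φ)ᶜ.ncard = Nat.card V := by
    rw [← Set.ncard_range_of_injective φ.injective, Set.ncard_add_ncard_compl]
  have hs : 0 < (Set.range φ)ᶜ.ncard := (Set.ncard_pos).2 hne
  have h1 := hconn.card_le_toNat_eRk_ground_add_one
  have h2 := toNat_eRk_cycleMatroid_add_card_connectedComponent_le φ
  have h3 := hreg.ncard_edgeSet_le φ
  have h4 := hG.ncard_mul_le (A := Sym2.map φ '' H.edgeSet) (by
    rintro _ ⟨e, he, rfl⟩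
    induction e with | h a b => exact φ.map_adj_iff.2 he)
  have h5 : 2 * G.edgeSet.ncard = Nat.card V * d := by
    have h := G.sum_degrees_eq_twice_card_edges
    have hsum : ∑ v, G.degree v = Fintype.card V * d := by
      rw [← smul_eq_mul, ← Finset.card_univ]
      exact Finset.sum_eq_card_nsmul fun v _ => by convert hreg v
    rw [← coe_edgeFinset, Set.ncard_coe_finset, Nat.card_eq_fintype_card, ← h, ← hsum]
    exact Finset.sum_congr rfl fun v _ => by convert rfl
  have h6 : (G.cycleMatroid.eRk G.cycleMatroid.E).toNat ≤ G.edgeSet.ncard :=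
    ENat.toNat_le_toNat (Matroid.eRk_le_encard _ _)
      (Set.encard_ne_top_iff.2 (Set.toFinite G.edgeSet))
  generalize (G.cycleMatroid.eRk G.cycleMatroid.E).toNat = r at *
  generalize (G.cycleMatroid.eRk (Sym2.map φ '' H.edgeSet)).toNat = a at *
  generalize (Sym2.map φ '' H.edgeSet).ncard = m at *
  generalize (Set.range φ)ᶜ.ncard = s at *
  generalize G.edgeSet.ncard = E at *
  generalize Nat.card H.ConnectedComponent = q at *
  generalize Nat.card V = n at *
  generalize Nat.card W = w at *
  by_contra! hq
  subst hW
  -- For `d = 0` there are no edges, so connectedness gives `n ≤ 1`, hence `w = 0` and `q = 0`.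
  rcases Nat.eq_zero_or_pos d with rfl | hd
  · omega
  have h7 : m * (w + s) ≤ E * a + m := by nlinarith
  zify at *
  -- The density inequality doubled, with `2 m ≥ n d - 2 s d` and `a ≤ w - q ≤ w - s - 1`. Expanded,
  -- it says `2 s d ≤ 0`.
  have h8 : ((w + s) * d - 2 * s * d) * (w + s - 1) ≤ (w + s) * d * (w - s - 1 : ℤ) := by
    nlinarith
  nlinarith [mul_pos hs hd]

/-- A graph of even order obtained from a connected regular uniformly dense graph by removing at
most one vertex has a perfect matching. -/
theorem UniformlyDense.hasPerfectMatching_of_even [Finite V] {H : SimpleGraph W}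
    {G : SimpleGraph V} [G.LocallyFinite] (hG : G.UniformlyDense) (hconn : G.Connected) {d : ℕ}
    (hreg : G.IsRegularOfDegree d) (φ : H ↪g G) (hφ : (Set.range φ)ᶜ.ncard ≤ 1)
    (heven : Even (Nat.card W)) : H.HasPerfectMatching := by
  have : Finite W := Finite.of_injective φ φ.injective
  have := Fintype.ofFinite W
  refine tutte.2 fun u hu => ?_
  rw [IsTutteViolator] at hu
  set K := ((⊤ : H.Subgraph).deleteVerts u).coe with hK
  let ι : K ↪g H := ⟨⟨Subtype.val, Subtype.val_injective⟩, by
    intro a b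
    have ha := a.2
    have hb := b.2
    simp only [Subgraph.deleteVerts_verts, Set.mem_sdiff] at ha hb
    simp [hK, ha.2, hb.2]⟩
  have hι : Set.range ι = uᶜ := by
    change Set.range Subtype.val = _
    ext x
    simp
  have hcardK : u.ncard + Nat.card ((⊤ : H.Subgraph).deleteVerts u).verts = Nat.card W := by
    rw [← Set.ncard_range_of_injective ι.injective, hι, Set.ncard_add_ncard_compl]
  have hodd := K.odd_ncard_oddComponents
  have hle : K.oddComponents.ncard ≤ Nat.card K.ConnectedComponent := Set.ncard_le_card _
  have hq : Nat.card K.ConnectedComponent ≤ u.ncard + 1 := by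
    -- Toughness needs a deleted vertex; with none, `K` is isomorphic to the connected `G`.
    rcases (Set.range (φ.comp ι))ᶜ.eq_empty_or_nonempty with h | h
    · have hsurj : Function.Surjective (φ.comp ι) := by
        rwa [Set.compl_empty_iff, Set.range_eq_univ] at h
      have hKc : K.Connected := (Iso.connected_iff (RelIso.ofSurjective (φ.comp ι) hsurj)).2 hconn
      have := hKc.preconnected.subsingleton_connectedComponent
      exact Finite.card_le_one_iff_subsingleton.2 this |>.trans (Nat.le_add_left 1 _)
    · refine (hG.card_connectedComponent_le hconn hreg (φ.comp ι) h).trans ?_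
      have hsub : (Set.range (φ.comp ι))ᶜ ⊆ φ '' u ∪ (Set.range φ)ᶜ := by
        intro x hx
        by_cases hxr : x ∈ Set.range φ
        · obtain ⟨w, rfl⟩ := hxr
          refine Or.inl ⟨w, ?_, rfl⟩
          by_contra hw
          obtain ⟨k, rfl⟩ : w ∈ Set.range ι := hι ▸ hw
          exact hx ⟨k, rfl⟩
        · exact Or.inr hxr
      refine (Set.ncard_le_ncard hsub (Set.toFinite _)).trans ((Set.ncard_union_le _ _).trans ?_)
      exact Nat.add_le_add (Set.ncard_image_le (Set.toFinite _)) hφ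
  -- The number of odd components has the parity of `|W| - |u|`, and `|W|` is even.
  have hpar : Odd K.oddComponents.ncard ↔ Odd u.ncard := by
    rw [hodd]
    grind
  grind

theorem HasPerfectMatching.even_card [Finite V] {G : SimpleGraph V} (h : G.HasPerfectMatching) :
    Even (Nat.card V) := by
  have := Fintype.ofFinite V
  obtain ⟨M, hM⟩ := h
  rw [Nat.card_eq_fintype_card]
  exact hM.even_card

end SimpleGraph

theorem mainTheorem11 {V : Type*} [Finite V] (G : SimpleGraph V) [G.LocallyFinite]
    (hconn : G.Connected) (d : ℕ) (hreg : G.IsRegularOfDegree d) (hud : G.UniformlyDense) :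
    Xor G.HasPerfectMatching (∀ v : V, (G.induce {v}ᶜ).HasPerfectMatching) := by
  have hcard (v : V) : 1 + Nat.card ({v}ᶜ : Set V) = Nat.card V := by
    rw [Nat.card_coe_set_eq, ← Set.ncard_singleton v, Set.ncard_add_ncard_compl]
  obtain ⟨v⟩ := hconn.nonempty
  -- The parity of `|V|` selects the alternative and excludes the other.
  rcases Nat.even_or_odd (Nat.card V) with h | h
  · refine Or.inl ⟨hud.hasPerfectMatching_of_even hconn hreg (SimpleGraph.Embedding.refl) ?_ h,
      fun hv => ?_⟩
    · change (Set.range id)ᶜ.ncard ≤ 1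
      simp
    · have := (hv v).even_card
      grind
  · refine Or.inr ⟨fun v => ?_, fun hG => ?_⟩
    · refine hud.hasPerfectMatching_of_even hconn hreg (SimpleGraph.Embedding.induce {v}ᶜ) ?_ ?_
      · change (Set.range Subtype.val)ᶜ.ncard ≤ 1
        simp
      · grind
    · exact Nat.not_even_iff_odd.2 h hG.even_card
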